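/- Let $n\in\{2,3\}$ and let $\Omega\subset\mathbb R^n$ be a bounded domain that is decomposed by flat fractures and their intersections into finitely many pairwise disjoint subdomains $\Omega^d_i$ ($0\le d\le n$, $i\in I^d$), each a relatively open subset of a $d$-dimensional plane; let $\partial\Omega_N\subseteq\partial\Omega$ be the no-flux part of the boundary. An interface $\Gamma^d_j$ ($0\le d\le n-1$) is a copy of some $\Omega^d_i$, regarded as a part of the boundary of an adjacent $\Omega^{d+1}_k$ seen from one side, with unit normal $\nu$ outward from $\Omega^{d+1}_k$. Let $\mathcal T^d_\Omega$ be conforming simplicial meshes of the $d$-dimensional subdomains that resolve the interfaces and $\partial\Omega_N$, and let $\mathcal T^d_\Gamma$ be arbitrary simplicial (mortar) meshes of the interfaces. The mesh $\mathcal T_\Omega$ is called $\sigma$-shape-regular if $\operatorname{diam}T\le\sigma\rho_T$ for every element $T$ of dimension at least $1$, where $\rho_T$ is the diameter of the inscribed ball of $T$. On every $\Omega^d_i$, $d\ge1$, let $K$ be a constant symmetric positive definite tensor on the tangent space, and let $\kappa\ge 1$ be such that on each subdomain the largest eigenvalue of $K$ is at most $\kappa$ times the smallest; thus $\kappa=1$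 is allowed if and only if $K$ is a scalar multiple of the identity on each subdomain. On every interface let $\gamma>0$ be constant and let $K_\nu$ be a measurable function bounded above and below by positive constants. For $1\le d\le n$ let $V^d_h=\mathbb{RT}_0(\mathcal T^d_\Omega)$ be the lowest-order Raviart–Thomas space of fields with $v\cdot\nu=0$ on $\partial\Omega_N$, with normal components continuous across the facets inside each subdomain; let $V^d_{0h}\subseteq V^d_h$ consist of the fields with zero normal component on the interfaces, let $\Lambda^d_h=\mathbb P_0(\mathcal T^d_\Gamma)$, $\Lambda_h=\bigoplus_{d=0}^{n-1}\Lambda_h^d$ and $W_h=\bigl(\bigoplus_{d=1}^n V^d_{0h}\bigr)\times\Lambda_h$. Let $R_h=\bigoplus_d R^d_h$ with $R^d_h:\Lambda^d_h\to V^{d+1}_h$ be a linear discrete extension operator: the normal trace of $R^d_h\mu$ on the $d$-dimensional interfaces is the $L^2$-projection of $\mu$ onto the space of normal traces of $V^{d+1}_h$, and its normal component vanishes on the rest of the boundary of the $(d+1)$-dimensional subdomains. For $r=[v_0,\mu]\in W_h$ put $v=v_0+R_h\mu$ and $$\|r\|_a^2=\sum_{d=1}^n\sum_{T\in\mathcal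 T^d_\Omega}(K^{-1}v,v)_{T}+(\gamma K_\nu^{-1}\mu,\mu)_\Gamma,$$ $$\|r\|_{a^D}^2=\sum_{d=1}^n\sum_{T\in\mathcal T^d_\Omega}\sum_{f\subset\partial T}(v\cdot\nu_f)^2\,(K^{-1}\phi_f,\phi_f)_T+(\gamma K_\nu^{-1}\mu,\mu)_\Gamma,$$ where $\nu_f$ is the unit outer normal of the facet $f$ of $T$ and $\phi_f\in\mathbb{RT}_0(T)$ is the basis function with normal component $1$ on $f$ and $0$ on the other facets of $T$. Then for every $\sigma$ there are constants $c_1,c_2>0$, depending only on $\sigma$, such that for all such data with a $\sigma$-shape-regular mesh $\mathcal T_\Omega$ and all $r\in W_h$ $$\frac{c_1}{\sqrt{\kappa}}\,\|r\|_{a^D}\le\|r\|_a\le c_2\,\|r\|_{a^D}.$$ In particular, if $K$ is a scalar multiple of the identity on each subdomain, then $c_1\|r\|_{a^D}\le\|r\|_a\le c_2\|r\|_{a^D}$, with constants that depend on the shape regularity of $\mathcal T_\Omega$ only. -/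

import Mathlib

open MeasureTheory Set
open scoped RealInnerProductSpace Topology

noncomputable section

namespace MixedDim

/-- The ambient Euclidean space `ℝⁿ`. -/
abbrev E (n : ℕ) : Type := EuclideanSpace ℝ (Fin n)

section Simplex

variable {n d : ℕ}

/-- The relative interior of a simplex: all barycentric coordinates are positive.
For a `0`-simplex this is the point itself. -/
def relInt (S : Affine.Simplex ℝ (E n) d) : Set (E n) :=
  S.setInterior (Ioi 0)

/-- The relative interior of the facet of `S` opposite to the vertex `k`. -/
def facetInt (S : Affine.Simplex ℝ (E n) (d + 1)) (k : Fin (d + 2)) : Set (E n) :=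
  relInt (S.faceOpposite k)

/-- The unit outer normal (within the plane of `S`) of the facet of `S` opposite to the vertex `k`:
it points from the vertex `k` to the foot of the altitude through that vertex. -/
def outerNormal (S : Affine.Simplex ℝ (E n) (d + 1)) (k : Fin (d + 2)) : E n :=
  (S.height k)⁻¹ • (S.altitudeFoot k - S.points k)

/-- The local lowest-order Raviart-Thomas space on `S`: the fields `x ↦ a + b (x - x₀)` with `a`
tangential to `S`, `b` a number and `x₀` a vertex of `S`. -/
def RT0 (S : Affine.Simplex ℝ (E n) (d + 1)) : Submodule ℝ (E n → E n) where
  carrier := {v | ∃ a ∈ vectorSpan ℝ (range S.points), ∃ b : ℝ,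
    ∀ x, v x = a + b • (x - S.points 0)}
  add_mem' := by
    rintro v w ⟨a, ha, b, hv⟩ ⟨a', ha', b', hw⟩
    refine ⟨a + a', add_mem ha ha', b + b', fun x => ?_⟩
    rw [Pi.add_apply, hv, hw]
    module
  zero_mem' := ⟨0, zero_mem _, 0, fun x => by simp⟩
  smul_mem' := by
    rintro c v ⟨a, ha, b, hv⟩
    refine ⟨c • a, Submodule.smul_mem _ c ha, c * b, fun x => ?_⟩
    rw [Pi.smul_apply, hv]
    module

/-- The Raviart-Thomas basis function of the facet opposite to the vertex `k`: its normal component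
is `1` on that facet and `0` on all other facets of `S`. -/
def rtBasis (S : Affine.Simplex ℝ (E n) (d + 1)) (k : Fin (d + 2)) : E n → E n :=
  fun x => (S.height k)⁻¹ • (x - S.points k)

/-- The outer normal component `v · ν` of `v` on the facet opposite to the vertex `k`. It is
constant on the facet for `v` in `RT0 S`, and evaluated here at the centroid of the facet. -/
def flux (S : Affine.Simplex ℝ (E n) (d + 1)) (k : Fin (d + 2)) (v : E n → E n) : ℝ :=
  ⟪v (S.faceOppositeCentroid k), outerNormal S k⟫

end Simplex

/-- `Adjacent P A Q B ν`: the set `A`, in the plane `P`, is a part of the boundary of the set `B`,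
in the plane `Q`, and `B` lies on the side of `A` for which `ν` is the outward unit normal. -/
def Adjacent {n : ℕ} (P : AffineSubspace ℝ (E n)) (A : Set (E n))
    (Q : AffineSubspace ℝ (E n)) (B : Set (E n)) (ν : E n) : Prop :=
  ν ∈ Q.direction ∧ ν ∈ P.directionᗮ ∧ ‖ν‖ = 1 ∧
    ∀ x ∈ A, ∀ᶠ s : ℝ in 𝓝[>] 0, x - s • ν ∈ B

/-- The dimensional decomposition of a fractured porous medium in `ℝⁿ`. -/
structure Geometry (n : ℕ) where
  /-- the whole medium -/
  domain : Set (E n)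
  domain_open : IsOpen domain
  domain_bounded : Bornology.IsBounded domain
  domain_connected : IsConnected domain
  /-- the part of the outer boundary with the no-flux condition (the rest is the Dirichlet part) -/
  neumann : Set (E n)
  neumann_subset : neumann ⊆ frontier domain
  /-- the index sets of the `d`-dimensional subdomains -/
  I : ℕ → Type
  [finI : ∀ d, Fintype (I d)]
  /-- the plane of a subdomain -/
  plane : ∀ d, I d → AffineSubspace ℝ (E n)
  finrank_plane : ∀ d i, Module.finrank ℝ (plane d i).direction = d
  /-- the subdomains, relatively open in their planes -/
  dom : ∀ d, I d → Set (E n)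
  dom_nonempty : ∀ d i, (dom d i).Nonempty
  dom_open : ∀ d i, ∃ U, IsOpen U ∧ dom d i = U ∩ (plane d i : Set (E n))
  dom_subset : ∀ d i, dom d i ⊆ domain
  dom_disjoint : ∀ (p q : Σ d, I d), p ≠ q → Disjoint (dom p.1 p.2) (dom q.1 q.2)
  /-- up to fractures the subdomains of full dimension make up the medium -/
  dom_dense : domain ⊆ closure (⋃ i : I n, dom n i)
  /-- the index sets of the `d`-dimensional interfaces -/
  J : ℕ → Type
  [finJ : ∀ d, Fintype (J d)]
  /-- the `d`-dimensional subdomain with which an interface coincides as a set -/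
  lo : ∀ {d}, J d → I d
  /-- the `(d + 1)`-dimensional subdomain of whose boundary an interface is a part -/
  hi : ∀ {d}, J d → I (d + 1)
  /-- the unit normal on an interface, outward from the `(d + 1)`-dimensional subdomain; the two
  sides of a fracture inside one subdomain are two interfaces with opposite normals -/
  normal : ∀ {d}, J d → E n
  adjacent : ∀ {d} (f : J d), Adjacent (plane d (lo f)) (dom d (lo f))
    (plane (d + 1) (hi f)) (dom (d + 1) (hi f)) (normal f)
  interface_unique : ∀ {d} (f g : J d), lo f = lo g → hi f = hi g → normal f = normal g → f = g
  interface_complete : ∀ {d} (i : I d) (j : I (d + 1)) (ν : E n),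
    Adjacent (plane d i) (dom d i) (plane (d + 1) j) (dom (d + 1) j) ν →
      ∃ f : J d, lo f = i ∧ hi f = j ∧ normal f = ν

attribute [instance] Geometry.finI Geometry.finJ

/-- The set underlying an interface. -/
def Geometry.Gam {n : ℕ} (G : Geometry n) {d : ℕ} (f : G.J d) : Set (E n) :=
  G.dom d (G.lo f)

/-- A finite triangulation by `d`-simplices of a relatively open set `A` in a `d`-plane of `ℝⁿ`.
Conformity is required inside `A` only, so the two sides of a slit in `A` need not match. -/
structure Triangulation (n d : ℕ) (A : Set (E n)) where
  Elem : Type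
  [fin : Fintype Elem]
  simplex : Elem → Affine.Simplex ℝ (E n) d
  relInt_subset : ∀ t, relInt (simplex t) ⊆ A
  cover : A ⊆ ⋃ t, (simplex t).closedInterior
  disjoint : ∀ s t, s ≠ t → Disjoint (relInt (simplex s)) (relInt (simplex t))
  conforming : ∀ s t, s ≠ t →
    (simplex s).closedInterior ∩ (simplex t).closedInterior ∩ A ⊆
      convexHull ℝ (range (simplex s).points ∩ range (simplex t).points)

attribute [instance] Triangulation.fin

/-- The facet of `S` opposite to the vertex `k` lies on the interface `f`, with `S` on the side of
the higher-dimensional subdomain. -/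
def Geometry.OnInterface {n : ℕ} (G : Geometry n) {d : ℕ} (f : G.J d)
    (S : Affine.Simplex ℝ (E n) (d + 1)) (k : Fin (d + 2)) : Prop :=
  facetInt S k ⊆ G.Gam f ∧ outerNormal S k = G.normal f

/-- The meshes of the subdomains, and the mortar meshes of the interfaces. The facets of the
subdomain meshes resolve the boundaries of the subdomains, the interfaces and the Neumann boundary;
the mortar meshes are not related to the subdomain meshes. -/
structure Mesh {n : ℕ} (G : Geometry n) where
  sub : ∀ d (i : G.I d), Triangulation n d (G.dom d i)
  mortar : ∀ d (f : G.J d), Triangulation n d (G.Gam f)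
  resolves_dom : ∀ d (i : G.I (d + 1)) t k,
    facetInt ((sub (d + 1) i).simplex t) k ⊆ G.dom (d + 1) i ∨
      Disjoint (facetInt ((sub (d + 1) i).simplex t) k) (G.dom (d + 1) i)
  resolves_interface : ∀ d (f : G.J d) t k,
    facetInt ((sub (d + 1) (G.hi f)).simplex t) k ⊆ G.Gam f ∨
      Disjoint (facetInt ((sub (d + 1) (G.hi f)).simplex t) k) (G.Gam f)
  resolves_neumann : ∀ d (i : G.I (d + 1)) t k,
    facetInt ((sub (d + 1) i).simplex t) k ⊆ G.neumann ∨
      Disjoint (facetInt ((sub (d + 1) i).simplex t) k) G.neumann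

/-- The physical parameters: the permeability `K`, a symmetric positive definite tensor on the
tangent space of each subdomain of positive dimension, constant on the subdomain; the distances `γ`,
constant on each interface; and the normal permeability `Kν` on the interfaces. -/
structure Parameters {n : ℕ} (G : Geometry n) where
  K : ∀ d (i : G.I (d + 1)),
    (G.plane (d + 1) i).direction ≃ₗ[ℝ] (G.plane (d + 1) i).direction
  K_symm : ∀ d i x y, ⟪K d i x, y⟫ = ⟪x, K d i y⟫
  K_pos : ∀ d i x, x ≠ 0 → 0 < ⟪K d i x, x⟫
  γ : ∀ d, G.J d → ℝ
  γ_pos : ∀ d f, 0 < γ d f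
  Kν : ∀ d, G.J d → E n → ℝ
  Kν_measurable : ∀ d f, Measurable (Kν d f)
  Kν_bounds : ∀ d f, ∃ m M : ℝ, 0 < m ∧ ∀ x ∈ G.Gam f, m ≤ Kν d f x ∧ Kν d f x ≤ M

/-- On each subdomain the largest eigenvalue of `K` is at most `κ` times the smallest one. For
`κ = 1` this says that `K` is a scalar multiple of the identity on each subdomain. -/
def Parameters.AnisotropyLE {n : ℕ} {G : Geometry n} (P : Parameters G) (κ : ℝ) : Prop :=
  ∀ d (i : G.I (d + 1)), ∃ k : ℝ, 0 < k ∧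
    ∀ x, k * ‖x‖ ^ 2 ≤ ⟪P.K d i x, x⟫ ∧ ⟪P.K d i x, x⟫ ≤ κ * k * ‖x‖ ^ 2

namespace Mesh

variable {n : ℕ} {G : Geometry n} (M : Mesh G)

/-- The subdomain mesh is shape regular with constant `σ`: the diameter of every element of
positive dimension is at most `σ` times the diameter of its inscribed ball. -/
def ShapeRegular (σ : ℝ) : Prop :=
  ∀ d (i : G.I (d + 1)) t,
    Metric.diam ((M.sub (d + 1) i).simplex t).closedInterior ≤
      σ * (2 * ((M.sub (d + 1) i).simplex t).inradius)

/-- Elementwise vector fields on the `(d + 1)`-dimensional subdomain meshes. -/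
abbrev Field (d : ℕ) : Type :=
  ∀ i : G.I (d + 1), (M.sub (d + 1) i).Elem → E n → E n

/-- The mortar space of the `d`-dimensional interfaces: piecewise constants on the mortar mesh. -/
abbrev Lam (d : ℕ) : Type :=
  ∀ f : G.J d, (M.mortar d f).Elem → ℝ

/-- The Raviart-Thomas space on the `(d + 1)`-dimensional subdomains: elementwise Raviart-Thomas
fields with continuous normal components across all facets inside a subdomain, and vanishing
normal component on the Neumann boundary. -/
def Vh (d : ℕ) : Submodule ℝ (M.Field d) where
  carrier := {v |
    (∀ i t, v i t ∈ RT0 ((M.sub (d + 1) i).simplex t)) ∧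
    (∀ i s t k l, s ≠ t →
      range (((M.sub (d + 1) i).simplex s).faceOpposite k).points =
        range (((M.sub (d + 1) i).simplex t).faceOpposite l).points →
      facetInt ((M.sub (d + 1) i).simplex s) k ⊆ G.dom (d + 1) i →
      flux ((M.sub (d + 1) i).simplex s) k (v i s) +
        flux ((M.sub (d + 1) i).simplex t) l (v i t) = 0) ∧
    (∀ i t k, facetInt ((M.sub (d + 1) i).simplex t) k ⊆ G.neumann →
      flux ((M.sub (d + 1) i).simplex t) k (v i t) = 0)}
  add_mem' := by
    rintro v w ⟨h1, h2, h3⟩ ⟨g1, g2, g3⟩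
    refine ⟨fun i t => add_mem (h1 i t) (g1 i t), fun i s t k l hst hr hk => ?_,
      fun i t k hk => ?_⟩
    · have h := h2 i s t k l hst hr hk
      have g := g2 i s t k l hst hr hk
      simp only [flux, Pi.add_apply, inner_add_left] at h g ⊢
      linarith
    · have h := h3 i t k hk
      have g := g3 i t k hk
      simp only [flux, Pi.add_apply, inner_add_left] at h g ⊢
      linarith
  zero_mem' := ⟨fun i t => zero_mem _, fun i s t k l _ _ _ => by simp [flux],
    fun i t k _ => by simp [flux]⟩
  smul_mem' := by
    rintro c v ⟨h1, h2, h3⟩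
    refine ⟨fun i t => Submodule.smul_mem _ c (h1 i t), fun i s t k l hst hr hk => ?_,
      fun i t k hk => ?_⟩
    · have h := h2 i s t k l hst hr hk
      simp only [flux, Pi.smul_apply, real_inner_smul_left] at h ⊢
      rw [← mul_add, h, mul_zero]
    · have h := h3 i t k hk
      simp only [flux, Pi.smul_apply, real_inner_smul_left] at h ⊢
      rw [h, mul_zero]

/-- The subspace of `Vh` of the fields with vanishing normal component on the interfaces. -/
def V0h (d : ℕ) : Submodule ℝ (M.Field d) where
  carrier := {v | v ∈ M.Vh d ∧ ∀ (f : G.J d) t k,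
    G.OnInterface f ((M.sub (d + 1) (G.hi f)).simplex t) k →
      flux ((M.sub (d + 1) (G.hi f)).simplex t) k (v (G.hi f) t) = 0}
  add_mem' := by
    rintro v w ⟨hv, h⟩ ⟨hw, g⟩
    refine ⟨add_mem hv hw, fun f t k hk => ?_⟩
    have h := h f t k hk
    have g := g f t k hk
    simp only [flux, Pi.add_apply, inner_add_left] at h g ⊢
    linarith
  zero_mem' := ⟨zero_mem _, fun f t k _ => by simp [flux]⟩
  smul_mem' := by
    rintro c v ⟨hv, h⟩
    refine ⟨Submodule.smul_mem _ c hv, fun f t k hk => ?_⟩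
    have h := h f t k hk
    simp only [flux, Pi.smul_apply, real_inner_smul_left] at h ⊢
    rw [h, mul_zero]

/-- All pairs of an elementwise vector field and a mortar function, over all dimensions. -/
abbrev Flux : Type := (∀ d, M.Field d) × (∀ d, M.Lam d)

/-- The space `W_h` of the discrete flux variables `[v₀, μ]`. -/
def Wh : Submodule ℝ M.Flux :=
  (Submodule.pi univ fun d => M.V0h d).prod ⊤

/-- The function on the interface `f` given by the element values of a mortar function. -/
def mortarFun {d : ℕ} (μ : M.Lam d) (f : G.J d) : E n → ℝ :=
  fun x => ∑ m, (relInt ((M.mortar d f).simplex m)).indicator (fun _ => μ f m) x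

open Classical in
/-- The normal trace `v · ν` on the interface `f`, a function constant on each facet of the
adjacent subdomain mesh that lies on `f`. -/
def normalTrace {d : ℕ} (v : M.Field d) (f : G.J d) : E n → ℝ :=
  fun x => ∑ t, ∑ k,
    if G.OnInterface f ((M.sub (d + 1) (G.hi f)).simplex t) k then
      (facetInt ((M.sub (d + 1) (G.hi f)).simplex t) k).indicator
        (fun _ => flux ((M.sub (d + 1) (G.hi f)).simplex t) k (v (G.hi f) t)) x
    else 0

/-- `g` is the `L²`-projection of the mortar function `μ` onto the space of the normal traces on
the `d`-dimensional interfaces of the fields in `Vh`. -/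
def IsProjection {d : ℕ} (μ : M.Lam d) (g : G.J d → E n → ℝ) : Prop :=
  (∃ v ∈ M.Vh d, ∀ f, g f = M.normalTrace v f) ∧
    ∀ w ∈ M.Vh d, ∑ f : G.J d,
      ∫ x in G.Gam f, (g f x - M.mortarFun μ f x) * M.normalTrace w f x ∂μHE[d] = 0

/-- `R` is a discrete extension operator: `R μ` lies in `Vh`, its normal trace on the interfaces is
the `L²`-projection of `μ`, and its normal component vanishes elsewhere on the boundaries of the
subdomains. -/
def IsExtension (R : ∀ d, M.Lam d →ₗ[ℝ] M.Field d) : Prop :=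
  ∀ d (μ : M.Lam d), R d μ ∈ M.Vh d ∧ M.IsProjection μ (M.normalTrace (R d μ)) ∧
    ∀ i t k, Disjoint (facetInt ((M.sub (d + 1) i).simplex t) k) (G.dom (d + 1) i) →
      (∀ f : G.J d, G.hi f = i → ¬ G.OnInterface f ((M.sub (d + 1) i).simplex t) k) →
      flux ((M.sub (d + 1) i).simplex t) k (R d μ i t) = 0

variable (P : Parameters G)

/-- `(K⁻¹ u, w)_T` for an element `T`. The fields are tangential to `T`; the orthogonal projections
onto the tangent space only change their type. -/
def massElem {d : ℕ} (i : G.I (d + 1)) (t : (M.sub (d + 1) i).Elem) (u w : E n → E n) : ℝ :=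
  ∫ x in ((M.sub (d + 1) i).simplex t).closedInterior,
    ⟪(P.K d i).symm ((G.plane (d + 1) i).direction.orthogonalProjectionOnto (u x)),
      (G.plane (d + 1) i).direction.orthogonalProjectionOnto (w x)⟫ ∂μHE[d + 1]

/-- `(K⁻¹ u, w)_Ω`; points do not contribute. -/
def mass (u w : ∀ d, M.Field d) : ℝ :=
  ∑ d ∈ Finset.range n, ∑ i : G.I (d + 1), ∑ t, M.massElem P i t (u d i t) (w d i t)

/-- The diagonal version `(K⁻¹ u, w)_{D,Ω}`. -/
def massD (u w : ∀ d, M.Field d) : ℝ :=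
  ∑ d ∈ Finset.range n, ∑ i : G.I (d + 1), ∑ t, ∑ k,
    flux ((M.sub (d + 1) i).simplex t) k (u d i t) *
      flux ((M.sub (d + 1) i).simplex t) k (w d i t) *
      M.massElem P i t (rtBasis ((M.sub (d + 1) i).simplex t) k)
        (rtBasis ((M.sub (d + 1) i).simplex t) k)

/-- The mortar term `(γ Kν⁻¹ ρ, μ)_Γ`. -/
def mortarMass (ρ μ : ∀ d, M.Lam d) : ℝ :=
  ∑ d ∈ Finset.range n, ∑ f : G.J d,
    ∫ x in G.Gam f,
      P.γ d f * (P.Kν d f x)⁻¹ * M.mortarFun (ρ d) f x * M.mortarFun (μ d) f x ∂μHE[d]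

/-- The total flux `v₀ + R μ` of `r = [v₀, μ]`. -/
def total (R : ∀ d, M.Lam d →ₗ[ℝ] M.Field d) (r : M.Flux) : ∀ d, M.Field d :=
  fun d => r.1 d + R d (r.2 d)

/-- The bilinear form `a`. -/
def a (R : ∀ d, M.Lam d →ₗ[ℝ] M.Field d) (w r : M.Flux) : ℝ :=
  M.mass P (M.total R w) (M.total R r) + M.mortarMass P w.2 r.2

/-- The bilinear form `a^D`. -/
def aD (R : ∀ d, M.Lam d →ₗ[ℝ] M.Field d) (w r : M.Flux) : ℝ :=
  M.massD P (M.total R w) (M.total R r) + M.mortarMass P w.2 r.2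

/-- The norm induced by `a`. -/
def normA (R : ∀ d, M.Lam d →ₗ[ℝ] M.Field d) (r : M.Flux) : ℝ :=
  Real.sqrt (M.a P R r r)

/-- The norm induced by `a^D`. -/
def normAD (R : ∀ d, M.Lam d →ₗ[ℝ] M.Field d) (r : M.Flux) : ℝ :=
  Real.sqrt (M.aD P R r r)

end Mesh

end MixedDim

end

/-!
The mortar terms of the two norms agree, so it suffices to compare the two mass forms element by
element. On an element with facets `f` a Raviart-Thomas field is `v = ∑ (v · ν_f) φ_f`, and the
Cauchy-Schwarz inequality in the sum over the facets bounds the mass form of `v` by the number of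
facets times its diagonal.

Conversely, `|φ_f| ≤ 2σ` on a shape-regular element, so each term of the diagonal is at most a
multiple of `(v · ν_f)² |T|`. The components of `v` are affine, and an affine function satisfies
`g c = 2 g ((c + x) / 2) - g x`. Integrating the square over `x ∈ T`, where `c` is the centroid of
`f`, and noting that `x ↦ (c + x) / 2` maps `T` into itself, bounds `|v c|² |T|`, hence
`(v · ν_f)² |T|`, by a multiple of the integral of `|v|²`. Replacing `|v|²` by `K⁻¹ v · v` costs the
factor `κ`.

Shape regularity bounds the dimension: the reciprocal of the inradius of a simplex is the sum of the
reciprocals of its heights, so a shape-regular simplex with `d + 1` facets has `d + 1 ≤ 2σ`.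
-/

noncomputable section

namespace MixedDim

section HausdorffMeasure

variable {V P F : Type*} [NormedAddCommGroup V] [NormedSpace ℝ V] [NormedAddCommGroup F]
  [MetricSpace P] [NormedAddTorsor V P] [MeasurableSpace P] [BorelSpace P]

theorem measure_ne_top_of_isCompact_of_subset_affineSubspace {A : AffineSubspace ℝ P}
    [FiniteDimensional ℝ A.direction] {s : Set P} (hs : IsCompact s) (hsA : s ⊆ A) :
    μHE[Module.finrank ℝ A.direction] s ≠ ⊤ := by
  obtain rfl | ⟨p, hp⟩ := s.eq_empty_or_nonempty
  · simp
  let e : A.direction → P := fun w => (w : V) +ᵥ p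
  have he : Isometry e :=
    (IsometryEquiv.vaddConst p).isometry.comp A.direction.subtypeₗᵢ.isometry
  have hse : e '' (e ⁻¹' s) = s := image_preimage_eq_of_subset fun x hx =>
    ⟨⟨x -ᵥ p, A.vsub_mem_direction (hsA hx) (hsA hp)⟩, vsub_vadd x p⟩
  borelize ↥A.direction
  rw [← hse, he.euclideanHausdorffMeasure_image]
  exact (he.isClosedEmbedding.isCompact_preimage hs).measure_lt_top.ne

theorem measure_closedInterior_ne_top {d : ℕ} (S : Affine.Simplex ℝ P d) :
    μHE[d] S.closedInterior ≠ ⊤ := by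
  have hd : Module.finrank ℝ (affineSpan ℝ (range S.points)).direction = d := by
    rw [direction_affineSpan, S.independent.finrank_vectorSpan (Fintype.card_fin _)]
  have : FiniteDimensional ℝ (affineSpan ℝ (range S.points)).direction := by
    rw [direction_affineSpan]
    infer_instance
  conv in μHE[d] => rw [← hd]
  exact measure_ne_top_of_isCompact_of_subset_affineSubspace S.isCompact_closedInterior
    S.closedInterior_subset_affineSpan

theorem integrableOn_closedInterior {d : ℕ} (S : Affine.Simplex ℝ P d) {f : P → F}
    (hf : Continuous f) : IntegrableOn f S.closedInterior μHE[d] :=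
  hf.continuousOn.integrableOn_of_subset_isCompact S.isCompact_closedInterior
    S.isClosed_closedInterior.measurableSet Subset.rfl (measure_closedInterior_ne_top S)

theorem measurableEmbedding_homothety (c : P) {r : ℝ} (hr : r ≠ 0) :
    MeasurableEmbedding (AffineMap.homothety c r : P → P) :=
  (Topology.IsOpenEmbedding.of_continuous_injective_isOpenMap
    (AffineMap.homothety_continuous c r) (AffineMap.homothety_injective c hr)
    (AffineMap.homothety_isOpenMap c r hr)).measurableEmbedding

theorem map_homothety_euclideanHausdorffMeasure (d : ℕ) (c : P) {r : ℝ} (hr : r ≠ 0) :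
    (μHE[d] : Measure P).map (AffineMap.homothety c r) = ‖r‖₊⁻¹ ^ d • μHE[d] := by
  ext s hs
  rw [Measure.map_apply (measurableEmbedding_homothety c hr).measurable hs,
    euclideanHausdorffMeasure_homothety_preimage d c hr, Measure.smul_apply]

end HausdorffMeasure

section InverseEstimate

variable {V F : Type*} [NormedAddCommGroup V] [NormedSpace ℝ V] [NormedAddCommGroup F]
  [NormedSpace ℝ F]

theorem sq_norm_apply_le_midpoint (g : V →ᵃ[ℝ] F) (c x : V) :
    ‖g c‖ ^ 2 ≤ 8 * ‖g (midpoint ℝ c x)‖ ^ 2 + 2 * ‖g x‖ ^ 2 := by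
  have hgc : g c = (2 : ℝ) • g (midpoint ℝ c x) - g x := by
    rw [g.map_midpoint, two_smul, midpoint_add_self, add_sub_cancel_right]
  have hnorm : ‖g c‖ ≤ 2 * ‖g (midpoint ℝ c x)‖ + ‖g x‖ := by
    rw [hgc]
    exact (norm_sub_le _ _).trans_eq (by rw [norm_smul, Real.norm_two])
  calc ‖g c‖ ^ 2 ≤ (2 * ‖g (midpoint ℝ c x)‖ + ‖g x‖) ^ 2 := by gcongr
    _ ≤ 2 * ((2 * ‖g (midpoint ℝ c x)‖) ^ 2 + ‖g x‖ ^ 2) := add_sq_le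
    _ = 8 * ‖g (midpoint ℝ c x)‖ ^ 2 + 2 * ‖g x‖ ^ 2 := by ring

variable [MeasurableSpace V] [BorelSpace V]

theorem setIntegral_comp_homothety_le (d : ℕ) {s : Set V} {c : V} (hs : StarConvex ℝ c s) {r : ℝ}
    (hr0 : 0 < r) (hr1 : r ≤ 1) {f : V → ℝ} (hf : IntegrableOn f s μHE[d]) (hf0 : 0 ≤ f) :
    ∫ x in s, f (AffineMap.homothety c r x) ∂μHE[d] ≤ r⁻¹ ^ d * ∫ x in s, f x ∂μHE[d] := by
  have hmaps : AffineMap.homothety c r '' s ⊆ s := by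
    rintro _ ⟨x, hx, rfl⟩
    rw [AffineMap.homothety_eq_lineMap]
    exact hs.segment_subset hx (lineMap_mem_segment ℝ c x ⟨hr0.le, hr1⟩)
  calc ∫ x in s, f (AffineMap.homothety c r x) ∂μHE[d]
      = ∫ x in AffineMap.homothety c r '' s, f x ∂(μHE[d].map (AffineMap.homothety c r)) := by
        rw [(measurableEmbedding_homothety c hr0.ne').setIntegral_map,
          preimage_image_eq _ (AffineMap.homothety_injective c hr0.ne')]
    _ = r⁻¹ ^ d * ∫ x in AffineMap.homothety c r '' s, f x ∂μHE[d] := by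
        rw [map_homothety_euclideanHausdorffMeasure d c hr0.ne', Measure.restrict_smul,
          integral_smul_nnreal_measure, NNReal.smul_def, smul_eq_mul]
        simp [abs_of_pos hr0]
    _ ≤ r⁻¹ ^ d * ∫ x in s, f x ∂μHE[d] :=
        mul_le_mul_of_nonneg_left (setIntegral_mono_set hf (ae_of_all _ hf0) hmaps.eventuallyLE)
          (by positivity)

theorem sq_norm_apply_mul_measureReal_le (d : ℕ) {s : Set V} {c : V} (hs : StarConvex ℝ c s)
    (hsc : IsCompact s) (hsm : μHE[d] s ≠ ⊤) (g : V →ᴬ[ℝ] F) :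
    ‖g c‖ ^ 2 * (μHE[d] : Measure V).real s ≤
      (8 * 2 ^ d + 2) * ∫ x in s, ‖g x‖ ^ 2 ∂μHE[d] := by
  have integrableOn {f : V → ℝ} (hf : Continuous f) : IntegrableOn f s μHE[d] :=
    hf.continuousOn.integrableOn_of_subset_isCompact hsc hsc.measurableSet Subset.rfl hsm
  have hg : Continuous fun x => ‖g x‖ ^ 2 := by fun_prop
  have hmid : Continuous fun x => ‖g (midpoint ℝ c x)‖ ^ 2 := by
    simpa only [homothety_inv_two] using! hg.comp (AffineMap.homothety_continuous c (2⁻¹ : ℝ))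
  have hmid_le := setIntegral_comp_homothety_le d hs (r := 2⁻¹) (by norm_num) (by norm_num)
    (integrableOn hg) fun x => sq_nonneg ‖g x‖
  simp only [homothety_inv_two, inv_inv] at hmid_le
  calc ‖g c‖ ^ 2 * (μHE[d] : Measure V).real s = ∫ _ in s, ‖g c‖ ^ 2 ∂μHE[d] := by
        rw [setIntegral_const, smul_eq_mul, mul_comm]
    _ ≤ ∫ x in s, (8 * ‖g (midpoint ℝ c x)‖ ^ 2 + 2 * ‖g x‖ ^ 2) ∂μHE[d] :=
        setIntegral_mono (integrableOn continuous_const)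
          (integrableOn ((hmid.const_mul 8).add (hg.const_mul 2)))
          fun x => sq_norm_apply_le_midpoint g.toAffineMap c x
    _ = 8 * ∫ x in s, ‖g (midpoint ℝ c x)‖ ^ 2 ∂μHE[d] + 2 * ∫ x in s, ‖g x‖ ^ 2 ∂μHE[d] := by
        rw [integral_add ((integrableOn hmid).const_mul 8) ((integrableOn hg).const_mul 2),
          integral_const_mul, integral_const_mul]
    _ ≤ (8 * 2 ^ d + 2) * ∫ x in s, ‖g x‖ ^ 2 ∂μHE[d] := by linarith

end InverseEstimate

section SimplexGeometry

theorem affineSpan_setInterior_Ioi {V P : Type*} [AddCommGroup V] [Module ℝ V] [AddTorsor V P]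
    {d : ℕ} (S : Affine.Simplex ℝ P d) :
    affineSpan ℝ (S.setInterior (Ioi 0)) = affineSpan ℝ (range S.points) := by
  refine le_antisymm (affineSpan_le.2 S.setInterior_subset_affineSpan) (affineSpan_le.2 ?_)
  rintro _ ⟨j, rfl⟩
  -- The vertex `j` is the reflection of the centroid in the midpoint of the centroid and `j`.
  let comb : (Fin (d + 1) → ℝ) →ᵃ[ℝ] P := Finset.univ.affineCombination ℝ S.points
  let w : Fin (d + 1) → ℝ := Finset.univ.centroidWeights ℝ
  have hw : ∑ i, w i = 1 :=
    Finset.univ.sum_centroidWeights_eq_one_of_nonempty ℝ Finset.univ_nonempty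
  have hw_pos (i : Fin (d + 1)) : 0 < w i := by
    simp only [w, Finset.centroidWeights_apply, Finset.card_univ, Fintype.card_fin]
    positivity
  let e : Fin (d + 1) → ℝ := Pi.single j 1
  have he : ∑ i, e i = 1 := by simp [e]
  have he_nonneg : 0 ≤ e := Pi.single_nonneg.2 zero_le_one
  let mid : Fin (d + 1) → ℝ := midpoint ℝ w e
  have hmid_apply (i : Fin (d + 1)) : mid i = 2⁻¹ * (w i + e i) := by
    simp [mid, midpoint_eq_smul_add, mul_add]
  have hmid_sum : ∑ i, mid i = 1 := by
    simp only [hmid_apply, ← Finset.mul_sum, Finset.sum_add_distrib, hw, he]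
    norm_num
  have hmid_pos (i : Fin (d + 1)) : 0 < mid i := by
    rw [hmid_apply]
    exact mul_pos (by norm_num) (add_pos_of_pos_of_nonneg (hw_pos i) (he_nonneg i))
  have hmem : comb w ∈ affineSpan ℝ (S.setInterior (Ioi 0)) := mem_affineSpan ℝ ⟨w, hw, hw_pos, rfl⟩
  have hmem_mid : comb mid ∈ affineSpan ℝ (S.setInterior (Ioi 0)) :=
    mem_affineSpan ℝ ⟨mid, hmid_sum, hmid_pos, rfl⟩
  have hpoint : AffineEquiv.pointReflection ℝ (comb mid) (comb w) = S.points j := by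
    rw [comb.map_midpoint, AffineEquiv.pointReflection_midpoint_left]
    exact Finset.univ.affineCombination_piSingle ℝ S.points (Finset.mem_univ j)
  rw [← hpoint, AffineEquiv.pointReflection_apply]
  exact AffineSubspace.vadd_mem_of_mem_direction
    (AffineSubspace.vsub_mem_direction hmem_mid hmem) hmem_mid

theorem faceOppositeCentroid_mem_closedInterior {V P : Type*} [AddCommGroup V] [Module ℝ V]
    [AddTorsor V P] {d : ℕ} [NeZero d] (S : Affine.Simplex ℝ P d) (k : Fin (d + 1)) :
    S.faceOppositeCentroid k ∈ S.closedInterior := by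
  refine S.closedInterior_faceOpposite_subset_closedInterior k
    ⟨Finset.univ.centroidWeights ℝ,
      Finset.univ.sum_centroidWeights_eq_one_of_nonempty ℝ Finset.univ_nonempty, fun i => ?_, rfl⟩
  rw [Finset.centroidWeights_apply]
  exact ⟨by positivity, inv_le_one_of_one_le₀ (by simp)⟩

variable {V P : Type*} [NormedAddCommGroup V] [InnerProductSpace ℝ V] [MetricSpace P]
  [NormedAddTorsor V P] {d : ℕ} [NeZero d] (S : Affine.Simplex ℝ P d) (k : Fin (d + 1))

theorem inv_inradius_eq_sum_inv_height : S.inradius⁻¹ = ∑ k, (S.height k)⁻¹ := by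
  rw [S.inradius_eq_abs_inv_sum, abs_inv, inv_inv]
  simp only [Affine.Simplex.excenterWeightsUnnorm_empty_apply]
  exact abs_of_nonneg (by positivity)

theorem inradius_le_height : S.inradius ≤ S.height k := by
  rw [← inv_le_inv₀ (S.height_pos k) S.inradius_pos, inv_inradius_eq_sum_inv_height]
  exact Finset.single_le_sum (f := fun j => (S.height j)⁻¹) (fun j _ => by positivity)
    (Finset.mem_univ k)

theorem height_le_dist_of_mem_affineSpan_faceOpposite {x : P}
    (hx : x ∈ affineSpan ℝ (range (S.faceOpposite k).points)) :
    S.height k ≤ dist (S.points k) x :=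
  (EuclideanGeometry.dist_orthogonalProjection_eq_infDist _ _).trans_le
    (Metric.infDist_le_dist_of_mem hx)

theorem height_le_diam_closedInterior : S.height k ≤ Metric.diam S.closedInterior :=
  (height_le_dist_of_mem_affineSpan_faceOpposite S k
    (S.faceOpposite k).centroid_mem_affineSpan).trans
    (Metric.dist_le_diam_of_mem S.isCompact_closedInterior.isBounded
      (S.point_mem_closedInterior k) (faceOppositeCentroid_mem_closedInterior S k))

theorem succ_mul_inradius_le_diam_closedInterior :
    (d + 1) * S.inradius ≤ Metric.diam S.closedInterior := by
  have hr := S.inradius_pos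
  have hdiam : 0 < Metric.diam S.closedInterior :=
    (S.height_pos 0).trans_le (height_le_diam_closedInterior S 0)
  have hsum : (d + 1) * (Metric.diam S.closedInterior)⁻¹ ≤ S.inradius⁻¹ := by
    calc (d + 1) * (Metric.diam S.closedInterior)⁻¹
        = ∑ _k : Fin (d + 1), (Metric.diam S.closedInterior)⁻¹ := by simp
      _ ≤ ∑ k, (S.height k)⁻¹ := Finset.sum_le_sum fun k _ =>
          inv_anti₀ (S.height_pos k) (height_le_diam_closedInterior S k)
      _ = S.inradius⁻¹ := (inv_inradius_eq_sum_inv_height S).symm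
  rwa [← div_eq_mul_inv, div_le_iff₀ hdiam, inv_mul_eq_div, le_div_iff₀ hr] at hsum

end SimplexGeometry

section QuadraticForms

theorem apply_sum_sum_le_card_mul_sum {V ι : Type*} [AddCommGroup V] [Module ℝ V]
    {B : LinearMap.BilinForm ℝ V} (hB : B.IsPosSemidef) (s : Finset ι) (w : ι → V) :
    B (∑ i ∈ s, w i) (∑ i ∈ s, w i) ≤ s.card * ∑ i ∈ s, B (w i) (w i) := by
  have hpolar (i j : ι) : B (w i) (w j) ≤ (B (w i) (w i) + B (w j) (w j)) / 2 := by
    have hsub := hB.nonneg (w i - w j)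
    have hsymm := hB.eq (w i) (w j)
    simp only [map_sub, LinearMap.sub_apply] at hsub hsymm
    linarith
  calc B (∑ i ∈ s, w i) (∑ i ∈ s, w i) = ∑ i ∈ s, ∑ j ∈ s, B (w i) (w j) := by
        simp only [map_sum, LinearMap.sum_apply]
        exact Finset.sum_comm
    _ ≤ ∑ i ∈ s, ∑ j ∈ s, (B (w i) (w i) + B (w j) (w j)) / 2 :=
        Finset.sum_le_sum fun i _ => Finset.sum_le_sum fun j _ => hpolar i j
    _ = s.card * ∑ i ∈ s, B (w i) (w i) := by
        simp only [← Finset.sum_div, Finset.sum_add_distrib, Finset.sum_const, nsmul_eq_mul,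
          ← Finset.mul_sum]
        ring

theorem continuous_apply_self_of_finiteDimensional {X V : Type*} [TopologicalSpace X]
    [NormedAddCommGroup V] [NormedSpace ℝ V] [FiniteDimensional ℝ V] (B : LinearMap.BilinForm ℝ V)
    {u : X → V} (hu : Continuous u) : Continuous fun x => B (u x) (u x) :=
  (B.toContinuousBilinearMap.continuous.comp hu).clm_apply hu

variable {V : Type*} [NormedAddCommGroup V] [InnerProductSpace ℝ V] {L : V ≃ₗ[ℝ] V} {k : ℝ}

theorem mul_inner_symm_apply_le_sq_norm (hL : ∀ x, k * ‖x‖ ^ 2 ≤ ⟪L x, x⟫) (hk : 0 < k) (y : V) :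
    k * ⟪L.symm y, y⟫ ≤ ‖y‖ ^ 2 := by
  have hlow := hL (L.symm y)
  have hsq := sq_nonneg ‖k • L.symm y - y‖
  rw [L.apply_symm_apply, real_inner_comm] at hlow
  rw [norm_sub_sq_real, norm_smul, mul_pow, Real.norm_eq_abs, sq_abs, real_inner_smul_left] at hsq
  nlinarith

theorem sq_norm_le_mul_inner_symm_apply (hpos : L.toLinearMap.IsPositive)
    (hL : ∀ x, ⟪L x, x⟫ ≤ k * ‖x‖ ^ 2) (hk : 0 < k) (y : V) : ‖y‖ ^ 2 ≤ k * ⟪L.symm y, y⟫ := by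
  have hup := hL y
  have hsymm : ⟪L y, L.symm y⟫ = ‖y‖ ^ 2 := by
    have := hpos.isSymmetric y (L.symm y)
    simpa using this
  have hnonneg := hpos.re_inner_nonneg_left (k • L.symm y - y)
  simp only [LinearEquiv.coe_coe, map_sub, map_smul, L.apply_symm_apply, inner_sub_left,
    inner_sub_right, real_inner_smul_left, real_inner_smul_right, hsymm,
    real_inner_self_eq_norm_sq, RCLike.re_to_real, real_inner_comm (L.symm y) y] at hnonneg
  nlinarith

end QuadraticForms

section RaviartThomas

theorem exists_sum_eq_zero_and_eq_sum_smul_of_mem_vectorSpan_range {ι V : Type*} [Fintype ι]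
    [AddCommGroup V] [Module ℝ V] {p : ι → V} {a : V} (ha : a ∈ vectorSpan ℝ (range p)) :
    ∃ w : ι → ℝ, ∑ i, w i = 0 ∧ a = ∑ i, w i • p i := by
  classical
  obtain ⟨s, w, hw, rfl⟩ := mem_vectorSpan_iff_eq_weightedVSub ℝ |>.1 ha
  refine ⟨fun i => if i ∈ s then w i else 0, ?_, ?_⟩
  · rwa [Finset.sum_ite_mem, Finset.univ_inter]
  · rw [s.weightedVSub_eq_linear_combination hw]
    simp only [ite_smul, zero_smul, Finset.sum_ite_mem, Finset.univ_inter]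

variable {n d : ℕ} (S : Affine.Simplex ℝ (E n) (d + 1)) (k : Fin (d + 2)) {v : E n → E n}

theorem norm_outerNormal : ‖outerNormal S k‖ = 1 := by
  rw [outerNormal, norm_smul, norm_inv, Real.norm_of_nonneg (S.height_pos k).le, ← dist_eq_norm,
    dist_comm]
  exact inv_mul_cancel₀ (S.height_pos k).ne'

theorem inner_sub_outerNormal_eq_zero {x y : E n}
    (hx : x ∈ affineSpan ℝ (range (S.faceOpposite k).points))
    (hy : y ∈ affineSpan ℝ (range (S.faceOpposite k).points)) :
    ⟪x - y, outerNormal S k⟫ = 0 := by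
  have hfoot : S.altitudeFoot k - S.points k ∈
      (affineSpan ℝ (range (S.faceOpposite k).points)).directionᗮ :=
    EuclideanGeometry.orthogonalProjection_vsub_mem_direction_orthogonal _ _
  exact Submodule.inner_right_of_mem_orthogonal (AffineSubspace.vsub_mem_direction hx hy)
    (Submodule.smul_mem _ _ hfoot)

theorem inner_faceOppositeCentroid_sub_outerNormal (j : Fin (d + 2)) :
    ⟪S.faceOppositeCentroid k - S.points j, outerNormal S k⟫ =
      if j = k then S.height k else 0 := by
  have hcentroid : S.faceOppositeCentroid k ∈ affineSpan ℝ (range (S.faceOpposite k).points) :=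
    (S.faceOpposite k).centroid_mem_affineSpan
  split_ifs with hjk
  · have hfoot : S.altitudeFoot k - S.points k = S.height k • outerNormal S k := by
      rw [outerNormal, smul_inv_smul₀ (S.height_pos k).ne']
    rw [hjk, ← sub_add_sub_cancel _ (S.altitudeFoot k), inner_add_left,
      inner_sub_outerNormal_eq_zero S k hcentroid (S.altitudeFoot_mem_affineSpan_faceOpposite k),
      hfoot, real_inner_smul_left, real_inner_self_eq_norm_sq, norm_outerNormal]
    ring
  · refine inner_sub_outerNormal_eq_zero S k hcentroid (mem_affineSpan ℝ ?_)
    rw [S.range_faceOpposite_points]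
    exact mem_image_of_mem _ hjk

theorem flux_rtBasis (j : Fin (d + 2)) : flux S k (rtBasis S j) = if j = k then 1 else 0 := by
  rw [flux, rtBasis, real_inner_smul_left, inner_faceOppositeCentroid_sub_outerNormal]
  split_ifs with hjk
  · rw [hjk, inv_mul_cancel₀ (S.height_pos k).ne']
  · rw [mul_zero]

theorem flux_sum_smul {ι : Type*} (s : Finset ι) (c : ι → ℝ) (w : ι → E n → E n) :
    flux S k (∑ i ∈ s, c i • w i) = ∑ i ∈ s, c i * flux S k (w i) := by
  simp only [flux, Finset.sum_apply, Pi.smul_apply, sum_inner, real_inner_smul_left]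

theorem sq_flux_le_sq_norm (v : E n → E n) :
    flux S k v ^ 2 ≤ ‖v (S.faceOppositeCentroid k)‖ ^ 2 := by
  have hcs := abs_real_inner_le_norm (v (S.faceOppositeCentroid k)) (outerNormal S k)
  rw [norm_outerNormal, mul_one] at hcs
  exact sq_le_sq.2 (hcs.trans (le_abs_self _))

theorem rtBasis_mem_RT0 : rtBasis S k ∈ RT0 S := by
  refine ⟨(S.height k)⁻¹ • (S.points 0 - S.points k), Submodule.smul_mem _ _
    (vsub_mem_vectorSpan ℝ (mem_range_self 0) (mem_range_self k)), (S.height k)⁻¹, fun x => ?_⟩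
  rw [rtBasis]
  module

variable {S}

theorem exists_eq_sum_smul_rtBasis (hv : v ∈ RT0 S) :
    ∃ c : Fin (d + 2) → ℝ, v = ∑ k, c k • rtBasis S k := by
  obtain ⟨a, ha, b, hv⟩ := hv
  obtain ⟨w, hw, rfl⟩ := exists_sum_eq_zero_and_eq_sum_smul_of_mem_vectorSpan_range ha
  -- With `u = b e₀ - w` the field is `∑ u_k (x - p_k)`, because `∑ w_k = 0`.
  refine ⟨fun k => ((if k = 0 then b else 0) - w k) * S.height k, funext fun x => ?_⟩
  have hterm (k : Fin (d + 2)) :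
      ((((if k = 0 then b else 0) - w k) * S.height k) • rtBasis S k) x =
        (if k = 0 then b • (x - S.points 0) else 0) - w k • x + w k • S.points k := by
    rw [Pi.smul_apply, rtBasis, mul_smul, smul_inv_smul₀ (S.height_pos k).ne']
    split_ifs with hk
    · rw [hk]
      module
    · module
  simp only [hv, Finset.sum_apply, hterm, Finset.sum_add_distrib, Finset.sum_sub_distrib,
    Finset.sum_ite_eq', Finset.mem_univ, if_true, ← Finset.sum_smul, hw]
  module

theorem eq_sum_flux_smul_rtBasis (hv : v ∈ RT0 S) : v = ∑ k, flux S k v • rtBasis S k := by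
  obtain ⟨c, rfl⟩ := exists_eq_sum_smul_rtBasis hv
  simp only [flux_sum_smul, flux_rtBasis, mul_ite, mul_one, mul_zero, Finset.sum_ite_eq',
    Finset.mem_univ, if_true]

theorem exists_continuousAffineMap_eq_of_mem_RT0 (hv : v ∈ RT0 S) :
    ∃ g : E n →ᴬ[ℝ] E n, ⇑g = v := by
  obtain ⟨a, -, b, hv⟩ := hv
  refine ⟨ContinuousAffineMap.const ℝ (E n) (a - b • S.points 0) +
    b • ContinuousAffineMap.id ℝ (E n), ?_⟩
  ext1 x
  simp only [hv, ContinuousAffineMap.add_apply, ContinuousAffineMap.smul_apply,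
    ContinuousAffineMap.coe_const, ContinuousAffineMap.coe_id, Function.const_apply, id]
  module

theorem continuous_of_mem_RT0 (hv : v ∈ RT0 S) : Continuous v := by
  obtain ⟨g, rfl⟩ := exists_continuousAffineMap_eq_of_mem_RT0 hv
  exact g.continuous

theorem apply_mem_vectorSpan_of_mem_RT0 (hv : v ∈ RT0 S) {x : E n} (hx : x ∈ S.closedInterior) :
    v x ∈ vectorSpan ℝ (range S.points) := by
  obtain ⟨a, ha, b, hv⟩ := hv
  rw [hv]
  exact add_mem ha (Submodule.smul_mem _ _ (vsub_mem_vectorSpan_of_mem_affineSpan_of_mem_affineSpan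
    (S.closedInterior_subset_affineSpan hx) (mem_affineSpan ℝ (mem_range_self 0))))

theorem sq_flux_mul_measureReal_le (hv : v ∈ RT0 S) :
    flux S k v ^ 2 * (μHE[d + 1] : Measure (E n)).real S.closedInterior ≤
      (8 * 2 ^ (d + 1) + 2) * ∫ x in S.closedInterior, ‖v x‖ ^ 2 ∂μHE[d + 1] := by
  obtain ⟨g, rfl⟩ := exists_continuousAffineMap_eq_of_mem_RT0 hv
  have hstar : StarConvex ℝ (S.faceOppositeCentroid k) S.closedInterior := by
    rw [← S.convexHull_eq_closedInterior]
    exact convex_convexHull ℝ _ |>.starConvex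
      (S.convexHull_eq_closedInterior ▸ faceOppositeCentroid_mem_closedInterior S k)
  exact (mul_le_mul_of_nonneg_right (sq_flux_le_sq_norm S k g) measureReal_nonneg).trans <|
    sq_norm_apply_mul_measureReal_le (d + 1) hstar S.isCompact_closedInterior
      (measure_closedInterior_ne_top S) g

theorem norm_rtBasis_le {σ : ℝ} (hσ : Metric.diam S.closedInterior ≤ σ * (2 * S.inradius))
    {x : E n} (hx : x ∈ S.closedInterior) : ‖rtBasis S k x‖ ≤ 2 * σ := by
  have hσ₀ : 0 ≤ σ := nonneg_of_mul_nonneg_left (Metric.diam_nonneg.trans hσ)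
    (mul_pos two_pos S.inradius_pos)
  rw [rtBasis, norm_smul, norm_inv, Real.norm_of_nonneg (S.height_pos k).le,
    inv_mul_le_iff₀ (S.height_pos k), ← dist_eq_norm]
  calc dist x (S.points k)
      ≤ Metric.diam S.closedInterior :=
        Metric.dist_le_diam_of_mem S.isCompact_closedInterior.isBounded hx
          (S.point_mem_closedInterior k)
    _ ≤ σ * (2 * S.inradius) := hσ
    _ ≤ σ * (2 * S.height k) := by
        gcongr
        exact inradius_le_height S k
    _ = S.height k * (2 * σ) := by ring

end RaviartThomas

section ElementEstimates

variable {n d : ℕ} {S : Affine.Simplex ℝ (E n) (d + 1)} {v : E n → E n}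
  {B : LinearMap.BilinForm ℝ (E n)}

theorem integrableOn_apply_self_of_mem_RT0 (B : LinearMap.BilinForm ℝ (E n)) (hv : v ∈ RT0 S) :
    IntegrableOn (fun x => B (v x) (v x)) S.closedInterior μHE[d + 1] :=
  integrableOn_closedInterior S
    (continuous_apply_self_of_finiteDimensional B (continuous_of_mem_RT0 hv))

theorem setIntegral_apply_self_le_mul_sum_sq_flux_mul (hB : B.IsPosSemidef) (hv : v ∈ RT0 S) :
    ∫ x in S.closedInterior, B (v x) (v x) ∂μHE[d + 1] ≤
      (d + 2) * ∑ k, flux S k v ^ 2 *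
        ∫ x in S.closedInterior, B (rtBasis S k x) (rtBasis S k x) ∂μHE[d + 1] := by
  have hint (k : Fin (d + 2)) : IntegrableOn
      (fun x => flux S k v ^ 2 * B (rtBasis S k x) (rtBasis S k x)) S.closedInterior μHE[d + 1] :=
    (integrableOn_apply_self_of_mem_RT0 B (rtBasis_mem_RT0 S k)).const_mul _
  have hpointwise (x : E n) : B (v x) (v x) ≤
      (d + 2) * ∑ k, flux S k v ^ 2 * B (rtBasis S k x) (rtBasis S k x) := by
    have hvx : v x = ∑ k, flux S k v • rtBasis S k x := by
      conv_lhs => rw [eq_sum_flux_smul_rtBasis hv]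
      simp only [Finset.sum_apply, Pi.smul_apply]
    have hsum := apply_sum_sum_le_card_mul_sum hB Finset.univ fun k => flux S k v • rtBasis S k x
    simpa only [← hvx, Finset.card_univ, Fintype.card_fin, Nat.cast_add, Nat.cast_ofNat, map_smul,
      LinearMap.smul_apply, smul_eq_mul, ← mul_assoc, ← sq] using hsum
  calc ∫ x in S.closedInterior, B (v x) (v x) ∂μHE[d + 1]
      ≤ ∫ x in S.closedInterior,
          (d + 2) * ∑ k, flux S k v ^ 2 * B (rtBasis S k x) (rtBasis S k x) ∂μHE[d + 1] :=
        setIntegral_mono (integrableOn_apply_self_of_mem_RT0 B hv)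
          ((integrable_finsetSum _ fun k _ => hint k).const_mul _) hpointwise
    _ = _ := by
        simp only [integral_const_mul, integral_finsetSum _ fun k _ => hint k]

theorem mul_setIntegral_rtBasis_le {a σ : ℝ} (hB : ∀ y, a * B y y ≤ ‖y‖ ^ 2)
    (hσ : Metric.diam S.closedInterior ≤ σ * (2 * S.inradius)) (k : Fin (d + 2)) :
    a * ∫ x in S.closedInterior, B (rtBasis S k x) (rtBasis S k x) ∂μHE[d + 1] ≤
      (2 * σ) ^ 2 * (μHE[d + 1] : Measure (E n)).real S.closedInterior := by
  rw [← integral_const_mul, mul_comm _ (Measure.real _ _), ← smul_eq_mul, ← setIntegral_const]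
  refine setIntegral_mono_on
    ((integrableOn_apply_self_of_mem_RT0 B (rtBasis_mem_RT0 S k)).const_mul a)
    (integrableOn_closedInterior S continuous_const) S.isCompact_closedInterior.measurableSet
    fun x hx => (hB _).trans ?_
  gcongr
  exact norm_rtBasis_le k hσ hx

theorem setIntegral_sq_norm_le_mul_setIntegral {b : ℝ}
    (hB : ∀ y ∈ vectorSpan ℝ (range S.points), ‖y‖ ^ 2 ≤ b * B y y) (hv : v ∈ RT0 S) :
    ∫ x in S.closedInterior, ‖v x‖ ^ 2 ∂μHE[d + 1] ≤
      b * ∫ x in S.closedInterior, B (v x) (v x) ∂μHE[d + 1] := by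
  rw [← integral_const_mul]
  exact setIntegral_mono_on
    (integrableOn_closedInterior S ((continuous_of_mem_RT0 hv).norm.pow 2))
    ((integrableOn_apply_self_of_mem_RT0 B hv).const_mul b)
    S.isCompact_closedInterior.measurableSet
    fun x hx => hB _ (apply_mem_vectorSpan_of_mem_RT0 hv hx)

theorem mul_sum_sq_flux_mul_setIntegral_rtBasis_le {a b σ : ℝ} (ha : ∀ y, a * B y y ≤ ‖y‖ ^ 2)
    (hb : ∀ y ∈ vectorSpan ℝ (range S.points), ‖y‖ ^ 2 ≤ b * B y y)
    (hσ : Metric.diam S.closedInterior ≤ σ * (2 * S.inradius)) (hv : v ∈ RT0 S) :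
    a * ∑ k, flux S k v ^ 2 *
        ∫ x in S.closedInterior, B (rtBasis S k x) (rtBasis S k x) ∂μHE[d + 1] ≤
      (d + 2) * (2 * σ) ^ 2 * (8 * 2 ^ (d + 1) + 2) *
        (b * ∫ x in S.closedInterior, B (v x) (v x) ∂μHE[d + 1]) := by
  set I := ∫ x in S.closedInterior, B (v x) (v x) ∂μHE[d + 1]
  set J := fun k => ∫ x in S.closedInterior, B (rtBasis S k x) (rtBasis S k x) ∂μHE[d + 1]
  have hfacet (k : Fin (d + 2)) :
      a * (flux S k v ^ 2 * J k) ≤ (2 * σ) ^ 2 * ((8 * 2 ^ (d + 1) + 2) * (b * I)) :=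
    calc a * (flux S k v ^ 2 * J k) = flux S k v ^ 2 * (a * J k) := by ring
      _ ≤ flux S k v ^ 2 * ((2 * σ) ^ 2 * μHE[d + 1].real S.closedInterior) :=
          mul_le_mul_of_nonneg_left (mul_setIntegral_rtBasis_le ha hσ k) (sq_nonneg _)
      _ = (2 * σ) ^ 2 * (flux S k v ^ 2 * μHE[d + 1].real S.closedInterior) := by ring
      _ ≤ (2 * σ) ^ 2 *
            ((8 * 2 ^ (d + 1) + 2) * ∫ x in S.closedInterior, ‖v x‖ ^ 2 ∂μHE[d + 1]) :=
          mul_le_mul_of_nonneg_left (sq_flux_mul_measureReal_le k hv) (sq_nonneg _)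
      _ ≤ (2 * σ) ^ 2 * ((8 * 2 ^ (d + 1) + 2) * (b * I)) := by
          gcongr
          exact setIntegral_sq_norm_le_mul_setIntegral hb hv
  calc a * ∑ k, flux S k v ^ 2 * J k
      ≤ ∑ _k : Fin (d + 2), (2 * σ) ^ 2 * ((8 * 2 ^ (d + 1) + 2) * (b * I)) := by
        rw [Finset.mul_sum]
        exact Finset.sum_le_sum fun k _ => hfacet k
    _ = (d + 2) * (2 * σ) ^ 2 * (8 * 2 ^ (d + 1) + 2) * (b * I) := by
        rw [Finset.sum_const, Finset.card_univ, Fintype.card_fin, nsmul_eq_mul]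
        push_cast
        ring

theorem add_two_le_of_diam_le {σ : ℝ}
    (hσ : Metric.diam S.closedInterior ≤ σ * (2 * S.inradius)) : (d + 2 : ℝ) ≤ 2 * σ := by
  have h := (succ_mul_inradius_le_diam_closedInterior S).trans hσ
  push_cast at h
  refine le_of_mul_le_mul_right ?_ S.inradius_pos
  linarith

end ElementEstimates

namespace Parameters

variable {n d : ℕ} {G : Geometry n} (P : Parameters G) (i : G.I (d + 1))

/-- The bilinear form `(y, z) ↦ K⁻¹ y · z` of a subdomain, extended to the ambient space by the
orthogonal projection onto the tangent space of the subdomain. `Mesh.massElem` is the integral of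
this form, by definition. -/
def resistivity : LinearMap.BilinForm ℝ (E n) :=
  (innerₗ (G.plane (d + 1) i).direction).compl₁₂
    ((P.K d i).symm.toLinearMap ∘ₗ
      (G.plane (d + 1) i).direction.orthogonalProjectionOnto.toLinearMap)
    (G.plane (d + 1) i).direction.orthogonalProjectionOnto.toLinearMap

theorem isPositive_K : (P.K d i).toLinearMap.IsPositive := by
  refine ⟨P.K_symm d i, fun x => ?_⟩
  rcases eq_or_ne x 0 with rfl | hx
  · simp
  · exact (P.K_pos d i x hx).le

theorem isPosSemidef_resistivity : (P.resistivity i).IsPosSemidef := by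
  have hsymm := (P.isPositive_K i).toLinearMap_symm
  refine { eq := fun y z => ?_, nonneg := fun y => ?_ }
  · exact (hsymm.isSymmetric _ _).trans (real_inner_comm _ _)
  · exact hsymm.re_inner_nonneg_left _

variable {P i} {k : ℝ}

theorem mul_resistivity_le_sq_norm (hK : ∀ x, k * ‖x‖ ^ 2 ≤ ⟪P.K d i x, x⟫) (hk : 0 < k)
    (y : E n) : k * P.resistivity i y y ≤ ‖y‖ ^ 2 := by
  refine (mul_inner_symm_apply_le_sq_norm hK hk _).trans ?_
  gcongr
  exact Submodule.norm_orthogonalProjectionOnto_apply_le _ y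

theorem sq_norm_le_mul_resistivity (hK : ∀ x, ⟪P.K d i x, x⟫ ≤ k * ‖x‖ ^ 2) (hk : 0 < k)
    {y : E n} (hy : y ∈ (G.plane (d + 1) i).direction) :
    ‖y‖ ^ 2 ≤ k * P.resistivity i y y := by
  have hproj : (G.plane (d + 1) i).direction.orthogonalProjectionOnto y = ⟨y, hy⟩ :=
    Submodule.orthogonalProjectionOnto_mem_subspace_eq_self ⟨y, hy⟩
  calc ‖y‖ ^ 2 = ‖(G.plane (d + 1) i).direction.orthogonalProjectionOnto y‖ ^ 2 := by
        rw [hproj, Submodule.coe_norm]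
    _ ≤ k * P.resistivity i y y := sq_norm_le_mul_inner_symm_apply (P.isPositive_K i) hK hk _

end Parameters

theorem sqrt_add_le_sqrt_mul_sqrt_add {x y z C : ℝ} (hxy : x ≤ C * y) (hz : 0 ≤ z) (hC : 1 ≤ C) :
    √(x + z) ≤ √C * √(y + z) := by
  rw [← Real.sqrt_mul (zero_le_one.trans hC)]
  refine Real.sqrt_le_sqrt ?_
  rw [mul_add]
  exact add_le_add hxy (le_mul_of_one_le_left hz hC)

/-- The factor by which the form `a` dominates the form `a^D` on a mesh of shape regularity `σ` and
a permeability of anisotropy `1`: a facet contributes `(2σ)²` through the size of its basis function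
and `8 · 2^d + 2` through the inverse estimate on a `d`-simplex, there are `d + 1` facets, and shape
regularity forces `d + 1 ≤ 2σ`. -/
def diagonalConstant (σ : ℝ) : ℝ :=
  (2 * σ) ^ 3 * (4 * 2 ^ (2 * σ) + 2)

theorem add_two_mul_le_diagonalConstant {d : ℕ} {σ : ℝ} (hd : (d + 2 : ℝ) ≤ 2 * σ) :
    (d + 2) * (2 * σ) ^ 2 * (8 * 2 ^ (d + 1) + 2) ≤ diagonalConstant σ := by
  have hpow : (8 * 2 ^ (d + 1) : ℝ) ≤ 4 * 2 ^ (2 * σ) :=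
    calc (8 * 2 ^ (d + 1) : ℝ) = 4 * 2 ^ ((d + 2 : ℕ) : ℝ) := by
          rw [Real.rpow_natCast]
          ring
      _ ≤ 4 * 2 ^ (2 * σ) := by
          gcongr
          · exact one_le_two
          · exact_mod_cast hd
  have hσ : 0 ≤ 2 * σ := le_trans (by positivity) hd
  calc (d + 2) * (2 * σ) ^ 2 * (8 * 2 ^ (d + 1) + 2)
      ≤ (2 * σ) * (2 * σ) ^ 2 * (4 * 2 ^ (2 * σ) + 2) := by gcongr
    _ = diagonalConstant σ := by
        rw [diagonalConstant]
        ring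

namespace Mesh

variable {n d : ℕ} {G : Geometry n} (M : Mesh G) (P : Parameters G)

theorem vectorSpan_le_direction_plane (i : G.I d) (t : (M.sub d i).Elem) :
    vectorSpan ℝ (range ((M.sub d i).simplex t).points) ≤ (G.plane d i).direction := by
  obtain ⟨U, -, hU⟩ := G.dom_open d i
  have hrelInt : relInt ((M.sub d i).simplex t) ⊆ G.plane d i :=
    ((M.sub d i).relInt_subset t).trans (hU.trans_subset inter_subset_right)
  rw [← direction_affineSpan, ← affineSpan_setInterior_Ioi]
  exact AffineSubspace.direction_le (affineSpan_le.2 hrelInt)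

theorem massElem_self_nonneg (i : G.I (d + 1)) (t : (M.sub (d + 1) i).Elem) (u : E n → E n) :
    0 ≤ M.massElem P i t u u :=
  integral_nonneg fun _ => (P.isPosSemidef_resistivity i).nonneg _

theorem mass_self_nonneg (u : ∀ d, M.Field d) : 0 ≤ M.mass P u u :=
  Finset.sum_nonneg fun _ _ => Finset.sum_nonneg fun _ _ => Finset.sum_nonneg fun _ _ =>
    M.massElem_self_nonneg P _ _ _

theorem massD_self_nonneg (u : ∀ d, M.Field d) : 0 ≤ M.massD P u u :=
  Finset.sum_nonneg fun _ _ => Finset.sum_nonneg fun _ _ => Finset.sum_nonneg fun _ _ =>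
    Finset.sum_nonneg fun _ _ => mul_nonneg (mul_self_nonneg _) (M.massElem_self_nonneg P _ _ _)

theorem mortarMass_self_nonneg (μ : ∀ d, M.Lam d) : 0 ≤ M.mortarMass P μ μ := by
  refine Finset.sum_nonneg fun d _ => Finset.sum_nonneg fun f _ => ?_
  obtain ⟨m, _, hm, hKν⟩ := P.Kν_bounds d f
  obtain ⟨U, hU, hdom⟩ := G.dom_open d (G.lo f)
  have hmeas : MeasurableSet (G.Gam f) := by
    rw [Geometry.Gam, hdom]
    exact hU.measurableSet.inter (AffineSubspace.closed_of_finiteDimensional _).measurableSet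
  refine setIntegral_nonneg hmeas fun x hx => ?_
  rw [mul_assoc (_ * _)]
  exact mul_nonneg (mul_nonneg (P.γ_pos d f).le (inv_nonneg.2 (hm.le.trans (hKν x hx).1)))
    (mul_self_nonneg _)

/-- The fields that are Raviart-Thomas fields on each element, without any condition on their
normal components across or on the facets. -/
def IsElementwiseRT0 (u : ∀ d, M.Field d) : Prop :=
  ∀ d i t, u d i t ∈ RT0 ((M.sub (d + 1) i).simplex t)

variable {M P}

theorem isElementwiseRT0_total {R : ∀ d, M.Lam d →ₗ[ℝ] M.Field d} (hR : M.IsExtension R)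
    {r : M.Flux} (hr : r ∈ M.Wh) : M.IsElementwiseRT0 (M.total R r) := fun d i t =>
  add_mem ((hr.1 d (mem_univ d)).1.1 i t) ((hR d (r.2 d)).1.1 i t)

variable {σ κ : ℝ} {u : ∀ d, M.Field d}

theorem massElem_self_le (hσ : M.ShapeRegular σ) (i : G.I (d + 1)) (t : (M.sub (d + 1) i).Elem)
    {v : E n → E n} (hv : v ∈ RT0 ((M.sub (d + 1) i).simplex t)) :
    M.massElem P i t v v ≤ 2 * σ * ∑ k, flux ((M.sub (d + 1) i).simplex t) k v ^ 2 *
      M.massElem P i t (rtBasis ((M.sub (d + 1) i).simplex t) k)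
        (rtBasis ((M.sub (d + 1) i).simplex t) k) :=
  (setIntegral_apply_self_le_mul_sum_sq_flux_mul (P.isPosSemidef_resistivity i) hv).trans <|
    mul_le_mul_of_nonneg_right (add_two_le_of_diam_le (hσ d i t)) <|
      Finset.sum_nonneg fun _ _ => mul_nonneg (sq_nonneg _) (M.massElem_self_nonneg P i t _)

theorem sum_sq_flux_mul_massElem_le (hσ : M.ShapeRegular σ) (hκ : 1 ≤ κ) (hP : P.AnisotropyLE κ)
    (i : G.I (d + 1)) (t : (M.sub (d + 1) i).Elem) {v : E n → E n}
    (hv : v ∈ RT0 ((M.sub (d + 1) i).simplex t)) :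
    ∑ k, flux ((M.sub (d + 1) i).simplex t) k v ^ 2 *
        M.massElem P i t (rtBasis ((M.sub (d + 1) i).simplex t) k)
          (rtBasis ((M.sub (d + 1) i).simplex t) k) ≤
      diagonalConstant σ * κ * M.massElem P i t v v := by
  obtain ⟨k, hk, hK⟩ := hP d i
  have hκk : 0 < κ * k := mul_pos (zero_lt_one.trans_le hκ) hk
  refine le_of_mul_le_mul_left ?_ hk
  refine (mul_sum_sq_flux_mul_setIntegral_rtBasis_le
    (Parameters.mul_resistivity_le_sq_norm (fun x => (hK x).1) hk)
    (fun y hy => Parameters.sq_norm_le_mul_resistivity (fun x => (hK x).2) hκk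
      (M.vectorSpan_le_direction_plane i t hy)) (hσ d i t) hv).trans ?_
  calc _ ≤ diagonalConstant σ * (κ * k * M.massElem P i t v v) :=
        mul_le_mul_of_nonneg_right
          (add_two_mul_le_diagonalConstant (add_two_le_of_diam_le (hσ d i t)))
          (mul_nonneg hκk.le (M.massElem_self_nonneg P i t v))
    _ = k * (diagonalConstant σ * κ * M.massElem P i t v v) := by ring

theorem mass_self_le (hσ : M.ShapeRegular σ) (hu : M.IsElementwiseRT0 u) :
    M.mass P u u ≤ 2 * σ * M.massD P u u := by
  simp only [mass, massD, Finset.mul_sum]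
  gcongr with d _ i _ t _
  simpa only [← Finset.mul_sum, ← sq] using massElem_self_le hσ i t (hu d i t)

theorem massD_self_le (hσ : M.ShapeRegular σ) (hκ : 1 ≤ κ) (hP : P.AnisotropyLE κ)
    (hu : M.IsElementwiseRT0 u) :
    M.massD P u u ≤ diagonalConstant σ * κ * M.mass P u u := by
  simp only [mass, massD, Finset.mul_sum]
  gcongr with d _ i _ t _
  simpa only [← sq] using sum_sq_flux_mul_massElem_le hσ hκ hP i t (hu d i t)

variable {R : ∀ d, M.Lam d →ₗ[ℝ] M.Field d} {r : M.Flux}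

theorem normA_le_sqrt_mul_normAD (hσ : M.ShapeRegular σ)
    (hu : M.IsElementwiseRT0 (M.total R r)) :
    M.normA P R r ≤ √(max 1 (2 * σ)) * M.normAD P R r := by
  refine sqrt_add_le_sqrt_mul_sqrt_add ?_ (M.mortarMass_self_nonneg P r.2) (le_max_left ..)
  exact (mass_self_le hσ hu).trans <|
    mul_le_mul_of_nonneg_right (le_max_right ..) (M.massD_self_nonneg P _)

theorem normAD_le_sqrt_mul_normA (hσ : M.ShapeRegular σ) (hκ : 1 ≤ κ) (hP : P.AnisotropyLE κ)
    (hu : M.IsElementwiseRT0 (M.total R r)) :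
    M.normAD P R r ≤ √(max 1 (diagonalConstant σ) * κ) * M.normA P R r := by
  refine sqrt_add_le_sqrt_mul_sqrt_add ?_ (M.mortarMass_self_nonneg P r.2)
    (one_le_mul_of_one_le_of_one_le (le_max_left ..) hκ)
  refine (massD_self_le hσ hκ hP hu).trans <|
    mul_le_mul_of_nonneg_right ?_ (M.mass_self_nonneg P _)
  gcongr
  exact le_max_right ..

end Mesh

end MixedDim

end

theorem mainTheorem2_general (σ : ℝ) :
    ∃ c₁ c₂ : ℝ, 0 < c₁ ∧ 0 < c₂ ∧
      ∀ (n : ℕ) (G : MixedDim.Geometry n) (M : MixedDim.Mesh G), M.ShapeRegular σ →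
      ∀ (κ : ℝ), 1 ≤ κ →
      ∀ (P : MixedDim.Parameters G), P.AnisotropyLE κ →
      ∀ (R : ∀ d, M.Lam d →ₗ[ℝ] M.Field d) (r : M.Flux), M.IsElementwiseRT0 (M.total R r) →
        c₁ / √κ * M.normAD P R r ≤ M.normA P R r ∧
          M.normA P R r ≤ c₂ * M.normAD P R r := by
  have hC : 0 < max 1 (MixedDim.diagonalConstant σ) := zero_lt_one.trans_le (le_max_left ..)
  refine ⟨(√(max 1 (MixedDim.diagonalConstant σ)))⁻¹, √(max 1 (2 * σ)), by positivity,
    by positivity, fun n G M hσ κ hκ P hP R r hu =>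
      ⟨?_, MixedDim.Mesh.normA_le_sqrt_mul_normAD hσ hu⟩⟩
  have hκ₀ : 0 < κ := zero_lt_one.trans_le hκ
  rw [div_eq_mul_inv, ← mul_inv, ← Real.sqrt_mul hC.le,
    inv_mul_le_iff₀ (Real.sqrt_pos.2 (mul_pos hC hκ₀))]
  exact MixedDim.Mesh.normAD_le_sqrt_mul_normA hσ hκ hP hu

/-- The constants depend on the shape regularity `σ` of the subdomain mesh only. For a permeability
that is a scalar multiple of the identity on each subdomain take `κ = 1`. -/
theorem mainTheorem2 (σ : ℝ) :
    ∃ c₁ c₂ : ℝ, 0 < c₁ ∧ 0 < c₂ ∧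
      ∀ (n : ℕ), n = 2 ∨ n = 3 →
      ∀ (G : MixedDim.Geometry n) (M : MixedDim.Mesh G), M.ShapeRegular σ →
      ∀ (κ : ℝ), 1 ≤ κ →
      ∀ (P : MixedDim.Parameters G), P.AnisotropyLE κ →
      ∀ (R : ∀ d, M.Lam d →ₗ[ℝ] M.Field d), M.IsExtension R →
      ∀ r ∈ M.Wh,
        c₁ / Real.sqrt κ * M.normAD P R r ≤ M.normA P R r ∧
          M.normA P R r ≤ c₂ * M.normAD P R r := by
  obtain ⟨c₁, c₂, hc₁, hc₂, h⟩ := mainTheorem2_general σ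
  exact ⟨c₁, c₂, hc₁, hc₂, fun n _ G M hσ κ hκ P hP R hR r hr =>
    h n G M hσ κ hκ P hP R r (MixedDim.Mesh.isElementwiseRT0_total hR hr)⟩
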